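/- Let $X$ be a separated real locally convex space with topology $\tau$ and weak topology $w$, let $X^*$ be its topological dual with the weak-star topology $w^*$, and let $Z:=X\times X^*$. For $z=(x,x^*)$, $z'=(x',x'^*)$ in $Z$ put $c(z):=x^*(x)$ and $z\cdot z':=x'^*(x)+x^*(x')$. A set $T\subset Z$ is monotone if $c(z-w)\ge0$ for all $z,w\in T$, and skew if $c=0$ on $T$. For $A\subset Z$ put $$A^\perp:=\{z'\in Z\mid z\cdot z'=0\ \forall z\in A\},\quad -A:=\{(x,x^*)\mid (x,-x^*)\in A\},$$ $$\sigma_A(z):=\sup_{u\in A}z\cdot u,\quad \operatorname{bar}A:=\operatorname{dom}\sigma_A,\quad p_A(z):=\inf\{t>0\mid z\in tA\}\ \ (\inf\emptyset:=+\infty),$$ where $\operatorname{dom}f:=[f<+\infty]$ and, e.g., $[f\le g]:=\{z\in Z\mid f(z)\le g(z)\}$. (Note that $-A$ changes only the sign of the second component.) For $T\subset Z$ let $c_T:=c$ on $T$ and $c_T:=+\infty$ on $Z\setminus T$. The Fitzpatrick function of $T$ is $$\varphi_T(z):=\sup\{z\cdot z'-c_T(z')\mid z'\in Z\},$$ and the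 Penot function of $T$ is $\psi_T:=\operatorname{cl}_{\tau\times w^*}\operatorname{conv}c_T$, that is, $$\psi_T(z):=\inf\{t\in\mathbb R\mid (z,t)\in\operatorname{cl}(\operatorname{conv}(\operatorname{epi}c_T))\},$$ the closure being taken for $\tau\times w^*$ and the usual topology of $\mathbb R$. For a nonempty $w\times w^*$-closed convex set $C\subset Z$ let $C_\infty:=\bigcap_{t>0}t(C-a)$ for some (equivalently, every) $a\in C$. Let $L\subset Z$ be a monotone linear subspace with skew part $S:=L\cap[c=0]$, nonempty positive part $P:=L\cap[c>0]$, unitary part $U:=L\cap[c=1]$ and crown $C:=\operatorname{cl}_{w\times w^*}(\operatorname{conv}U)$. Then: (i) $S$ is a skew linear subspace of $Z$. (ii) $S+U=U$, $S+P=P$ and $S\subset\operatorname{conv}U\subset C$; in particular $S\subset C_\infty$, and $\operatorname{bar}U=\operatorname{bar}C\subset S^\perp$. (iii) $\operatorname{conv}U=\{z\in L\mid c(z)\le1\}=[c_L\le1]$. (iv) $\varphi_L=\frac14\sigma_C^2$, $\operatorname{dom}\varphi_L=\operatorname{bar}C\subset S^\perp$ is a linear subspace of $Z$, and $\varphi_L(tz)=t^2\varphi_L(z)$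 for all $z\in Z$ and $t\in\mathbb R$ (with $0\cdot(+\infty):=0$). (v) $\psi_L=p_C^2$, $C=[\psi_L\le1]$, $C_\infty=[\psi_L=0]$, $\psi_L(tz)=t^2\psi_L(z)$ for all $z\in Z$ and $t\in\mathbb R$ (with $0\cdot(+\infty):=0$), $\operatorname{dom}\psi_L=\mathbb RC$ is a linear space, and $L\subset\operatorname{dom}\psi_L\subset\operatorname{cl}_{w\times w^*}L$. (vi) $-C_\infty$ is a $w\times w^*$-closed monotone linear subspace. (vii) If, moreover, $L$ is $w\times w^*$-closed, then $C_\infty=S$; in particular $C_\infty$ is skew and $S$ is $w\times w^*$-closed. -/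

import Mathlib

open scoped Pointwise Topology

noncomputable section

namespace MonotoneSubspace

/-- The space `Z = X × X*`, where `X*` is the topological dual of `X` with the weak-star topology.
Its instance topology is the product of the original topology of `X` and the weak-star topology. -/
abbrev Z (X : Type*) [AddCommGroup X] [Module ℝ X] [TopologicalSpace X]
    [IsTopologicalAddGroup X] [ContinuousSMul ℝ X] : Type _ :=
  X × WeakDual ℝ X

variable {X : Type*} [AddCommGroup X] [Module ℝ X] [TopologicalSpace X]
  [IsTopologicalAddGroup X] [ContinuousSMul ℝ X]

/-- The topology `w × w*` on `Z`: the weak topology on `X` times the weak-star topology on `X*`. -/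
@[reducible] def wwTop (X : Type*) [AddCommGroup X] [Module ℝ X] [TopologicalSpace X]
    [IsTopologicalAddGroup X] [ContinuousSMul ℝ X] : TopologicalSpace (Z X) :=
  TopologicalSpace.induced
    (fun z : Z X => ((toWeakSpace ℝ X z.1, z.2) : WeakSpace ℝ X × WeakDual ℝ X)) inferInstance

/-- The closure with respect to `w × w*`. -/
def clWW (A : Set (Z X)) : Set (Z X) := closure[wwTop X] A

/-- Closedness with respect to `w × w*`. -/
def IsClosedWW (A : Set (Z X)) : Prop := IsClosed[wwTop X] A

/-- The duality product `c(x, x*) = ⟨x, x*⟩`. -/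
def c (z : Z X) : ℝ := z.2 z.1

/-- The coupling `z · z' = ⟨x, x'*⟩ + ⟨x', x*⟩`. -/
def coupling (z z' : Z X) : ℝ := z'.2 z.1 + z.2 z'.1

/-- Monotonicity of (the graph of) an operator. -/
def IsMonotone (T : Set (Z X)) : Prop := ∀ z ∈ T, ∀ w ∈ T, 0 ≤ c (z - w)

/-- `A` is skew if `c` vanishes on `A`. -/
def IsSkew (A : Set (Z X)) : Prop := ∀ z ∈ A, c z = 0

/-- `A` is a linear subspace of `Z`. -/
def IsLinear (A : Set (Z X)) : Prop := ∃ M : Submodule ℝ (Z X), (M : Set (Z X)) = A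

/-- The operator `-A`, with graph `{(x, x*) | (x, -x*) ∈ A}`. -/
def opNeg (A : Set (Z X)) : Set (Z X) := {z | (z.1, -z.2) ∈ A}

/-- The orthogonal `A^⊥` with respect to the coupling. -/
def orth (A : Set (Z X)) : Set (Z X) := {z' | ∀ z ∈ A, coupling z z' = 0}

def skewPart (A : Set (Z X)) : Set (Z X) := {z ∈ A | c z = 0}

def positivePart (A : Set (Z X)) : Set (Z X) := {z ∈ A | 0 < c z}

def unitaryPart (A : Set (Z X)) : Set (Z X) := {z ∈ A | c z = 1}

/-- The crown of `A`: the `w × w*`-closed convex hull of its unitary part. -/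
def crown (A : Set (Z X)) : Set (Z X) := clWW (convexHull ℝ (unitaryPart A))

/-- The effective domain of an extended real valued function. -/
def dom {E : Type*} (f : E → EReal) : Set E := {z | f z < ⊤}

/-- The epigraph of an extended real valued function. -/
def epi {E : Type*} (f : E → EReal) : Set (E × ℝ) := {p | f p.1 ≤ (p.2 : EReal)}

open Classical in
/-- The indicator function `ι_A`: `0` on `A` and `+∞` elsewhere. -/
def indicator (A : Set (Z X)) (z : Z X) : EReal := if z ∈ A then 0 else ⊤

/-- `c_T = c + ι_T`. -/
def cOn (T : Set (Z X)) (z : Z X) : EReal := (c z : EReal) + indicator T z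

/-- The conjugate with respect to the coupling: `f^□(z) = sup {z · z' - f(z') | z' ∈ Z}`. -/
def conj (f : Z X → EReal) (z : Z X) : EReal := ⨆ z' : Z X, ((coupling z z' : ℝ) : EReal) - f z'

/-- The lsc convex hull of `f` with respect to the product of the topology of `X` and the weak-star
topology of `X*`: `(cl conv f)(z) = inf {t ∈ ℝ | (z, t) ∈ cl (conv (epi f))}`. -/
def clConv (f : Z X → EReal) (z : Z X) : EReal :=
  ⨅ t : {t : ℝ // (z, t) ∈ closure (convexHull ℝ (epi f))}, ((t : ℝ) : EReal)

/-- The Fitzpatrick function `φ_T = c_T^□`. -/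
def fitzpatrick (T : Set (Z X)) : Z X → EReal := conj (cOn T)

/-- The Penot function `ψ_T = cl conv c_T`. -/
def penot (T : Set (Z X)) : Z X → EReal := clConv (cOn T)

/-- The support function `σ_A(z) = sup {z · u | u ∈ A}`, with `σ_∅ = -∞`. -/
def support (A : Set (Z X)) (z : Z X) : EReal := ⨆ u : A, ((coupling z u : ℝ) : EReal)

/-- The barrier cone `bar A = dom σ_A`. -/
def bar (A : Set (Z X)) : Set (Z X) := dom (support A)

/-- The Minkowski functional `p_A(z) = inf {t > 0 | z ∈ tA}`, with `inf ∅ = +∞`. -/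
def minkowski (A : Set (Z X)) (z : Z X) : EReal :=
  ⨅ t : {t : ℝ // 0 < t ∧ z ∈ t • A}, ((t : ℝ) : EReal)

/-- The asymptotic cone `⋂_{t > 0} t(C - a)` of a nonempty closed convex set `C`, for some `a ∈ C`
(for such `C` the intersection does not depend on `a ∈ C`). -/
def asympCone (C : Set (Z X)) : Set (Z X) := {z | ∃ a ∈ C, ∀ t : ℝ, 0 < t → z ∈ t • (C - {a})}

end MonotoneSubspace

end

open MonotoneSubspace

/-! On `Z` the function `c` is a quadratic form with polar form the coupling, and `L` is monotone
exactly when `c ≥ 0` on `L`. Expanding `c (z - w) ≥ 0` gives `z · w ≤ c z + c w` on `L`. Scaling one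
argument shows that the null vectors of `c` in `L` are orthogonal to all of `L`, and the same
inequality makes `c_L` convex. Hence `conv U` is the unit sublevel set of `c_L`.

Since `c_L` is homogeneous of degree 2, this one sublevel set determines everything. For `r > 0`,
`φ_L(z) ≤ r` means that `z · l ≤ 2√r` on `conv U`, and `ψ_L(z) ≤ r` means that `z / √r` lies in the
crown. These equivalences (`fitzpatrick_le_iff_coupling_le`, `IsMonotone.penot_le_iff_mem_crown`)
yield the formulas for `φ_L` and `ψ_L`. By Hahn-Banach, `w × w*` and `τ × w*` have the same closed
convex sets, so the crown is an ordinary closure.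

Finally `c ≤ ψ_L` everywhere and `ψ_L = 0` on `C_∞`, so `c ≤ 0` there and `-C_∞` is monotone. If `L`
is closed, `C_∞ ⊆ L`, where `c ≥ 0`, which forces `c = 0`. -/

namespace MonotoneSubspace

/-! ### The quadratic form `c`, its polar form, and the two topologies on `Z`. -/

section Algebra

variable {X : Type*} [AddCommGroup X] [Module ℝ X] [TopologicalSpace X]
  [IsTopologicalAddGroup X] [ContinuousSMul ℝ X]

omit [IsTopologicalAddGroup X] [ContinuousSMul ℝ X] in
theorem dual_add_apply (y w : WeakDual ℝ X) (a : X) : (y + w) a = y a + w a := rfl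

omit [IsTopologicalAddGroup X] [ContinuousSMul ℝ X] in
theorem dual_smul_apply (t : ℝ) (y : WeakDual ℝ X) (a : X) : (t • y) a = t * y a := rfl

theorem coupling_comm (z w : Z X) : coupling z w = coupling w z := add_comm _ _

theorem coupling_add_right (z u w : Z X) :
    coupling z (u + w) = coupling z u + coupling z w := by
  simp only [coupling, Prod.fst_add, Prod.snd_add, map_add, dual_add_apply]; ring

theorem coupling_smul_right (t : ℝ) (z w : Z X) : coupling z (t • w) = t * coupling z w := by
  simp only [coupling, Prod.smul_fst, Prod.smul_snd, map_smul, dual_smul_apply, smul_eq_mul]; ring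

theorem coupling_add_left (z u w : Z X) :
    coupling (z + u) w = coupling z w + coupling u w := by
  rw [coupling_comm, coupling_add_right, coupling_comm w z, coupling_comm w u]

theorem coupling_smul_left (t : ℝ) (z w : Z X) : coupling (t • z) w = t * coupling z w := by
  rw [coupling_comm, coupling_smul_right, coupling_comm]

theorem coupling_self (z : Z X) : coupling z z = 2 * c z := by simp only [coupling, c]; ring

theorem c_add (z w : Z X) : c (z + w) = c z + c w + coupling z w := by
  simp only [coupling, c, Prod.fst_add, Prod.snd_add, map_add, dual_add_apply]; ring

theorem c_smul (t : ℝ) (z : Z X) : c (t • z) = t ^ 2 * c z := by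
  simp only [c, Prod.smul_fst, Prod.smul_snd, map_smul, dual_smul_apply, smul_eq_mul]; ring

theorem c_neg (z : Z X) : c (-z) = c z := by
  rw [← neg_one_smul ℝ z, c_smul]; ring

theorem c_zero : c (0 : Z X) = 0 := by
  rw [← zero_smul ℝ (0 : Z X), c_smul]; ring

theorem c_sub (z w : Z X) : c (z - w) = c z + c w - coupling z w := by
  rw [sub_eq_add_neg, c_add, c_neg, ← neg_one_smul ℝ w, coupling_smul_right]; ring

theorem continuous_coupling (z : Z X) : Continuous (coupling z) :=
  ((WeakDual.eval_continuous z.1).comp continuous_snd).add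
    ((map_continuous z.2).comp continuous_fst)

theorem convex_coupling_le (z : Z X) (r : ℝ) : Convex ℝ {u : Z X | coupling z u ≤ r} := by
  intro u hu v hv a b ha hb hab
  simp only [Set.mem_ofPred_eq] at *
  rw [coupling_add_right, coupling_smul_right, coupling_smul_right]
  calc _ ≤ a * r + b * r := by gcongr
    _ = r := by rw [← add_mul, hab, one_mul]

theorem isClosed_of_isClosedWW {A : Set (Z X)} (hA : IsClosedWW A) : IsClosed A := by
  have hcont : Continuous
      (fun z : Z X => ((toWeakSpace ℝ X z.1, z.2) : WeakSpace ℝ X × WeakDual ℝ X)) :=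
    ((toWeakSpaceCLM ℝ X).continuous.comp continuous_fst).prodMk continuous_snd
  exact hA.mono hcont.le_induced

instance [LocallyConvexSpace ℝ X] : LocallyConvexSpace ℝ (Z X) :=
  have : LocallyConvexSpace ℝ (WeakDual ℝ X) :=
    inferInstanceAs (LocallyConvexSpace ℝ (WeakBilin (topDualPairing ℝ X)))
  Prod.locallyConvexSpace

/-- Continuous linear functionals on `Z` are continuous for `w × w*`. -/
theorem isClosedWW_functional_le (f : Z X →L[ℝ] ℝ) (u : ℝ) : IsClosedWW {z : Z X | f z ≤ u} := by
  have h : Continuous fun p : WeakSpace ℝ X × WeakDual ℝ X =>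
      (f.comp (ContinuousLinearMap.inl ℝ X (WeakDual ℝ X))) ((toWeakSpace ℝ X).symm p.1) +
        f (0, p.2) := by
    refine Continuous.add ?_ (f.continuous.comp (by fun_prop))
    exact (WeakBilin.eval_continuous (topDualPairing ℝ X).flip
      (f.comp (ContinuousLinearMap.inl ℝ X (WeakDual ℝ X)))).comp continuous_fst
  refine isClosed_induced_iff.2 ⟨_, isClosed_le h (continuous_const (y := u)), ?_⟩
  ext z
  have : f z = f (z.1, 0) + f (0, z.2) := by rw [← map_add]; simp
  simp [this]

/-- By Hahn-Banach a closed convex set is an intersection of closed half-spaces, and each of these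
is already `w × w*`-closed. -/
theorem isClosedWW_of_convex [LocallyConvexSpace ℝ X] {A : Set (Z X)} (hA : Convex ℝ A)
    (hcl : IsClosed A) : IsClosedWW A := by
  let I := {p : (Z X →L[ℝ] ℝ) × ℝ // ∀ a ∈ A, p.1 a ≤ p.2}
  have h : A = ⋂ p : I, {z : Z X | p.1.1 z ≤ p.1.2} := by
    ext z
    simp only [Set.mem_iInter, Set.mem_ofPred_eq]
    refine ⟨fun hz p => p.2 z hz, fun hz => ?_⟩
    by_contra hzA
    obtain ⟨f, u, hu, hlt⟩ := geometric_hahn_banach_closed_point hA hcl hzA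
    exact absurd (hz ⟨(f, u), fun a ha => (hu a ha).le⟩) (not_le.2 hlt)
  rw [h]
  exact @isClosed_iInter _ _ (wwTop X) _ fun p => isClosedWW_functional_le p.1.1 p.1.2

theorem clWW_eq_closure [LocallyConvexSpace ℝ X] {A : Set (Z X)} (hA : Convex ℝ A) :
    clWW A = closure A := by
  have hcl : IsClosedWW (closure A) := isClosedWW_of_convex hA.closure isClosed_closure
  refine Set.Subset.antisymm ?_ ?_
  · exact @closure_minimal _ (wwTop X) _ _ subset_closure hcl
  · exact closure_minimal (@subset_closure _ (wwTop X) A)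
      (isClosed_of_isClosedWW (@isClosed_closure _ (wwTop X) A))

end Algebra

/-! ### Skew, positive and unitary parts of a monotone subspace. -/

section Subspace

variable {X : Type*} [AddCommGroup X] [Module ℝ X] [TopologicalSpace X]
  [IsTopologicalAddGroup X] [ContinuousSMul ℝ X] {L : Submodule ℝ (Z X)}

theorem cOn_le_coe_iff {z : Z X} {t : ℝ} : cOn (L : Set (Z X)) z ≤ t ↔ z ∈ L ∧ c z ≤ t := by
  by_cases hz : z ∈ L <;> simp [cOn, indicator, hz]

theorem IsMonotone.c_nonneg (hL : IsMonotone (L : Set (Z X))) {z : Z X} (hz : z ∈ L) :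
    0 ≤ c z := by
  simpa using hL z hz 0 L.zero_mem

theorem IsMonotone.coupling_le (hL : IsMonotone (L : Set (Z X))) {z w : Z X} (hz : z ∈ L)
    (hw : w ∈ L) : coupling z w ≤ c z + c w := by
  have := hL z hz w hw
  rw [c_sub] at this; linarith

theorem IsMonotone.coupling_eq_zero (hL : IsMonotone (L : Set (Z X))) {z w : Z X}
    (hz : z ∈ skewPart (L : Set (Z X))) (hw : w ∈ L) : coupling z w = 0 := by
  -- Replacing `z` by `t • z` leaves `c z = 0` unchanged, so a linear function of `t` is bounded
  -- above and its slope must vanish.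
  have key (t : ℝ) : t * coupling z w ≤ c w := by
    have := hL.coupling_le (L.smul_mem t hz.1) hw
    rwa [coupling_smul_left, c_smul, hz.2, mul_zero, zero_add] at this
  by_contra h
  have := key ((c w + 1) / coupling z w)
  rw [div_mul_cancel₀ _ h] at this
  linarith

theorem zero_mem_skewPart : (0 : Z X) ∈ skewPart (L : Set (Z X)) := ⟨L.zero_mem, c_zero⟩

theorem IsMonotone.isLinear_skewPart (hL : IsMonotone (L : Set (Z X))) :
    IsLinear (skewPart (L : Set (Z X))) := by
  refine ⟨⟨⟨⟨skewPart L, ?_⟩, zero_mem_skewPart⟩, ?_⟩, rfl⟩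
  · intro a b ha hb
    exact ⟨L.add_mem ha.1 hb.1, by rw [c_add, ha.2, hb.2, hL.coupling_eq_zero ha hb.1]; simp⟩
  · intro t a ha
    exact ⟨L.smul_mem t ha.1, by rw [c_smul, ha.2, mul_zero]⟩

theorem IsMonotone.c_skew_add (hL : IsMonotone (L : Set (Z X))) {s z : Z X}
    (hs : s ∈ skewPart (L : Set (Z X))) (hz : z ∈ L) : c (s + z) = c z := by
  rw [c_add, hs.2, hL.coupling_eq_zero hs hz]; ring

theorem IsMonotone.skewPart_add_unitaryPart (hL : IsMonotone (L : Set (Z X))) :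
    skewPart (L : Set (Z X)) + unitaryPart (L : Set (Z X)) = unitaryPart (L : Set (Z X)) := by
  refine Set.Subset.antisymm ?_ fun u hu => ⟨0, zero_mem_skewPart, u, hu, zero_add u⟩
  rintro _ ⟨s, hs, u, hu, rfl⟩
  exact ⟨L.add_mem hs.1 hu.1, (hL.c_skew_add hs hu.1).trans hu.2⟩

theorem IsMonotone.skewPart_add_positivePart (hL : IsMonotone (L : Set (Z X))) :
    skewPart (L : Set (Z X)) + positivePart (L : Set (Z X)) = positivePart (L : Set (Z X)) := by
  refine Set.Subset.antisymm ?_ fun u hu => ⟨0, zero_mem_skewPart, u, hu, zero_add u⟩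
  rintro _ ⟨s, hs, u, hu, rfl⟩
  exact ⟨L.add_mem hs.1 hu.1, (hL.c_skew_add hs hu.1).symm ▸ hu.2⟩

theorem neg_mem_unitaryPart {u : Z X} (hu : u ∈ unitaryPart (L : Set (Z X))) :
    -u ∈ unitaryPart (L : Set (Z X)) := ⟨L.neg_mem hu.1, (c_neg u).trans hu.2⟩

theorem inv_sqrt_smul_mem_unitaryPart {z : Z X} (hz : z ∈ L) (hc : 0 < c z) :
    (Real.sqrt (c z))⁻¹ • z ∈ unitaryPart (L : Set (Z X)) := by
  refine ⟨L.smul_mem _ hz, ?_⟩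
  rw [c_smul, inv_pow, Real.sq_sqrt hc.le, inv_mul_cancel₀ hc.ne']

theorem unitaryPart_nonempty (hne : (positivePart (L : Set (Z X))).Nonempty) :
    (unitaryPart (L : Set (Z X))).Nonempty :=
  let ⟨_, hp⟩ := hne
  ⟨_, inv_sqrt_smul_mem_unitaryPart hp.1 hp.2⟩

theorem IsMonotone.skewPart_subset_convexHull (hL : IsMonotone (L : Set (Z X)))
    (hne : (positivePart (L : Set (Z X))).Nonempty) :
    skewPart (L : Set (Z X)) ⊆ convexHull ℝ (unitaryPart (L : Set (Z X))) := by
  intro s hs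
  obtain ⟨u, hu⟩ := unitaryPart_nonempty hne
  -- `s` is the midpoint of `s + u` and `s - u`, both unitary.
  have h1 : s + u ∈ unitaryPart (L : Set (Z X)) :=
    hL.skewPart_add_unitaryPart.subset ⟨s, hs, u, hu, rfl⟩
  have h2 : s + -u ∈ unitaryPart (L : Set (Z X)) :=
    hL.skewPart_add_unitaryPart.subset ⟨s, hs, -u, neg_mem_unitaryPart hu, rfl⟩
  have := convex_convexHull ℝ (unitaryPart (L : Set (Z X))) (subset_convexHull ℝ _ h1)
    (subset_convexHull ℝ _ h2) (by norm_num : (0 : ℝ) ≤ 1 / 2)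
    (by norm_num : (0 : ℝ) ≤ 1 / 2) (by norm_num)
  convert this using 1
  module

/-- The convexity defect of `c` is `a * b * c (z - w)`, nonnegative by monotonicity. -/
theorem IsMonotone.convex_epi_cOn (hL : IsMonotone (L : Set (Z X))) :
    Convex ℝ (epi (cOn (L : Set (Z X)))) := by
  rintro ⟨z, r⟩ hz ⟨w, s⟩ hw a b ha hb hab
  obtain ⟨hz, hr⟩ := cOn_le_coe_iff.1 hz
  obtain ⟨hw, hs⟩ := cOn_le_coe_iff.1 hw
  refine cOn_le_coe_iff.2 ⟨L.add_mem (L.smul_mem a hz) (L.smul_mem b hw), ?_⟩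
  simp only [Prod.smul_mk, Prod.mk_add_mk, smul_eq_mul] at *
  rw [c_add, c_smul, c_smul, coupling_smul_left, coupling_smul_right]
  have h := mul_le_mul_of_nonneg_left (hL.coupling_le hz hw) (mul_nonneg ha hb)
  have hb' : b = 1 - a := by linarith
  calc _ ≤ a * c z + b * c w := by subst hb'; linarith
    _ ≤ _ := by gcongr

theorem IsMonotone.convexHull_unitaryPart (hL : IsMonotone (L : Set (Z X)))
    (hne : (positivePart (L : Set (Z X))).Nonempty) :
    convexHull ℝ (unitaryPart (L : Set (Z X))) = {z : Z X | z ∈ L ∧ c z ≤ 1} := by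
  refine Set.Subset.antisymm (convexHull_min (fun u hu => ⟨hu.1, hu.2.le⟩) ?_) ?_
  · intro z hz w hw a b ha hb hab
    have := hL.convex_epi_cOn (x := (z, 1)) (cOn_le_coe_iff.2 hz) (y := (w, 1))
      (cOn_le_coe_iff.2 hw) ha hb hab
    simpa [hab] using cOn_le_coe_iff.1 this
  · rintro z ⟨hz, h1⟩
    rcases (hL.c_nonneg hz).eq_or_lt with h0 | h0
    · exact hL.skewPart_subset_convexHull hne ⟨hz, h0.symm⟩
    · have hu := inv_sqrt_smul_mem_unitaryPart hz h0
      have hs : 0 < Real.sqrt (c z) := Real.sqrt_pos.2 h0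
      have hs1 : Real.sqrt (c z) ≤ 1 := Real.sqrt_le_one.2 h1
      -- `z` lies on the segment from `0` to its unitary normalisation, with weight `√(c z) ≤ 1`.
      have := convex_convexHull ℝ (unitaryPart (L : Set (Z X))) (subset_convexHull ℝ _ hu)
        (hL.skewPart_subset_convexHull hne zero_mem_skewPart) hs.le (sub_nonneg.2 hs1) (by ring)
      rwa [smul_smul, mul_inv_cancel₀ hs.ne', one_smul, smul_zero, add_zero] at this

end Subspace
-- Comparing nonnegative extended reals through real bounds.
section ExtendedReal

/-- Only positive thresholds are tested, because later arguments divide by `√r`. -/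
theorem ereal_eq_of_forall_pos {a b : EReal} (ha : 0 ≤ a) (hb : 0 ≤ b)
    (h : ∀ r : ℝ, 0 < r → (a ≤ r ↔ b ≤ r)) : a = b := by
  refine le_antisymm ?_ ?_
  · exact EReal.le_of_forall_lt_iff_le.1 fun r hr =>
      (h r (by exact_mod_cast hb.trans_lt hr)).2 hr.le
  · exact EReal.le_of_forall_lt_iff_le.1 fun r hr =>
      (h r (by exact_mod_cast ha.trans_lt hr)).1 hr.le

theorem ereal_pos_mul_le_iff {k r : ℝ} (hk : 0 < k) {b : EReal} (hb : 0 ≤ b) :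
    (k : EReal) * b ≤ r ↔ b ≤ ((r / k : ℝ) : EReal) := by
  induction b with
  | bot => simp at hb
  | top => simp [EReal.coe_mul_top_of_pos hk]
  | coe x =>
    rw [← EReal.coe_mul, EReal.coe_le_coe_iff, EReal.coe_le_coe_iff, le_div_iff₀ hk, mul_comm]

/-- The conjunct `0 ≤ r` is needed since `Real.sqrt` is `0` at negative reals. -/
theorem ereal_sq_le_iff {r : ℝ} {b : EReal} (hb : 0 ≤ b) :
    b ^ 2 ≤ r ↔ b ≤ (Real.sqrt r : EReal) ∧ 0 ≤ r := by
  induction b with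
  | bot => simp at hb
  | top => simp [sq]
  | coe x =>
    have hx : 0 ≤ x := by exact_mod_cast hb
    rw [← EReal.coe_pow, EReal.coe_le_coe_iff, EReal.coe_le_coe_iff]
    constructor
    · exact fun h => ⟨Real.le_sqrt_of_sq_le h, (sq_nonneg x).trans h⟩
    · rintro ⟨h, hr⟩
      exact (Real.le_sqrt hx hr).1 h

theorem ereal_lt_top_iff_exists_pos {a : EReal} : a < ⊤ ↔ ∃ r : ℝ, 0 < r ∧ a ≤ r := by
  constructor
  · intro h
    obtain ⟨r, hr, -⟩ := EReal.lt_iff_exists_real_btwn.1 h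
    exact ⟨max r 1, by positivity, hr.le.trans (by exact_mod_cast le_max_left r 1)⟩
  · rintro ⟨r, -, hr⟩
    exact hr.trans_lt (EReal.coe_lt_top r)

theorem ereal_nonneg_mul {k : ℝ} (hk : 0 ≤ k) {b : EReal} (hb : 0 ≤ b) : 0 ≤ (k : EReal) * b :=
  mul_nonneg (by exact_mod_cast hk) hb

theorem ereal_le_zero_iff {a : EReal} : a ≤ 0 ↔ ∀ r : ℝ, 0 < r → a ≤ r := by
  refine ⟨fun h r hr => h.trans (by exact_mod_cast hr.le), fun h => ?_⟩
  exact EReal.le_of_forall_lt_iff_le.1 fun r hr => h r (by exact_mod_cast hr)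

end ExtendedReal

/-! ### Asymptotic cone, gauge and barrier cone of a convex symmetric set containing `0`. -/

section ConvexSets

variable {X : Type*} [AddCommGroup X] [Module ℝ X] [TopologicalSpace X]
  [IsTopologicalAddGroup X] [ContinuousSMul ℝ X] {A : Set (Z X)}

theorem mem_smul_iff {t : ℝ} (ht : 0 < t) {z : Z X} : z ∈ t • A ↔ t⁻¹ • z ∈ A :=
  Set.mem_smul_set_iff_inv_smul_mem₀ ht.ne' A z

theorem smul_mem_of_abs_le_one (hA : Convex ℝ A) (h0 : 0 ∈ A) (hneg : ∀ z ∈ A, -z ∈ A)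
    {k : ℝ} (hk : |k| ≤ 1) {z : Z X} (hz : z ∈ A) : k • z ∈ A := by
  rcases le_total 0 k with h | h
  · exact hA.smul_mem_of_zero_mem h0 hz ⟨h, (abs_of_nonneg h) ▸ hk⟩
  · have := hA.smul_mem_of_zero_mem h0 (hneg z hz) (t := -k)
      ⟨neg_nonneg.2 h, (abs_of_nonpos h) ▸ hk⟩
    rwa [neg_smul_neg] at this

/-- Brings any scalar, zero included, into `[-1, 1]` while the positive factor `|t| + 1` can be
moved elsewhere. -/
theorem abs_div_abs_add_one_le (t : ℝ) : |t / (|t| + 1)| ≤ 1 := by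
  have : 0 < |t| + 1 := by positivity
  rw [abs_div, abs_of_pos this, div_le_one this]
  linarith

theorem asympCone_eq (hA : Convex ℝ A) (hcl : IsClosed A) (h0 : 0 ∈ A) :
    asympCone A = {z : Z X | ∀ s : ℝ, 0 < s → s • z ∈ A} := by
  ext z
  constructor
  · rintro ⟨a, ha, h⟩ s hs
    -- With `t = ε / s`, the hypothesis gives `a + (s / ε) • z ∈ A`. Shrinking by `ε` towards `0`
    -- gives `ε • a + s • z ∈ A`, and `ε → 0` removes the base point.
    have hlim : Filter.Tendsto (fun ε : ℝ => ε • a + s • z) (𝓝[>] 0) (𝓝 (s • z)) := by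
      have : Continuous fun ε : ℝ => ε • a + s • z := by fun_prop
      have := this.tendsto 0
      simp only [zero_smul, zero_add] at this
      exact this.mono_left nhdsWithin_le_nhds
    refine hcl.mem_of_tendsto hlim ?_
    filter_upwards [Ioo_mem_nhdsGT (zero_lt_one (α := ℝ))] with ε hε
    obtain ⟨b, hb, a', ha', hba⟩ := (mem_smul_iff (div_pos hε.1 hs)).1 (h _ (div_pos hε.1 hs))
    rw [Set.mem_singleton_iff] at ha'
    subst ha'
    have hbz : b = a' + (s / ε) • z := by
      rw [inv_div] at hba
      rw [← hba]; simp
    have := hA.smul_mem_of_zero_mem h0 hb ⟨hε.1.le, hε.2.le⟩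
    rwa [hbz, smul_add, smul_smul, mul_div_cancel₀ _ hε.1.ne'] at this
  · intro h
    refine ⟨0, h0, fun t ht => (mem_smul_iff ht).2 ?_⟩
    exact ⟨_, h _ (inv_pos.2 ht), 0, rfl, sub_zero _⟩

theorem isLinear_asympCone (hA : Convex ℝ A) (hcl : IsClosed A) (h0 : 0 ∈ A)
    (hneg : ∀ z ∈ A, -z ∈ A) : IsLinear (asympCone A) := by
  rw [asympCone_eq hA hcl h0]
  refine ⟨⟨⟨⟨_, ?_⟩, fun s _ => by simpa using h0⟩, ?_⟩, rfl⟩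
  · intro z w hz hw s hs
    have := hA (hz (2 * s) (by positivity)) (hw (2 * s) (by positivity))
      (by norm_num : (0 : ℝ) ≤ 1 / 2) (by norm_num : (0 : ℝ) ≤ 1 / 2) (by norm_num)
    convert this using 1
    module
  · intro t z hz s hs
    have := smul_mem_of_abs_le_one hA h0 hneg (abs_div_abs_add_one_le t)
      (hz (s * (|t| + 1)) (by positivity))
    convert this using 1
    rw [smul_smul, smul_smul]
    congr 1
    field_simp

theorem isClosed_asympCone (hA : Convex ℝ A) (hcl : IsClosed A) (h0 : 0 ∈ A) :
    IsClosed (asympCone A) := by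
  rw [asympCone_eq hA hcl h0]
  have : {z : Z X | ∀ s : ℝ, 0 < s → s • z ∈ A} =
      ⋂ s : Set.Ioi (0 : ℝ), (fun z : Z X => (s : ℝ) • z) ⁻¹' A := by
    ext z; simp
  rw [this]
  exact isClosed_iInter fun s => hcl.preimage (continuous_const_smul _)

theorem minkowski_nonneg (z : Z X) : 0 ≤ minkowski A z :=
  le_iInf fun t => by exact_mod_cast t.2.1.le

theorem minkowski_le_coe_iff (hA : Convex ℝ A) (hcl : IsClosed A) (h0 : 0 ∈ A) {s : ℝ}
    (hs : 0 < s) {z : Z X} : minkowski A z ≤ s ↔ s⁻¹ • z ∈ A := by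
  constructor
  · intro h
    -- The infimum need not be known to be attained: membership holds for every `r > s` and passes
    -- to the limit by closedness.
    have hlim : Filter.Tendsto (fun r : ℝ => r⁻¹ • z) (𝓝[>] s) (𝓝 (s⁻¹ • z)) :=
      (((continuousAt_inv₀ hs.ne').tendsto).smul_const z).mono_left nhdsWithin_le_nhds
    refine hcl.mem_of_tendsto hlim ?_
    filter_upwards [self_mem_nhdsWithin] with r hr
    have hr : s < r := hr
    obtain ⟨⟨t, ht, hz⟩, htr⟩ := iInf_lt_iff.1 (h.trans_lt (EReal.coe_lt_coe_iff.2 hr))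
    have htr : t < r := by exact_mod_cast htr
    have hr0 : 0 < r := ht.trans htr
    have := hA.smul_mem_of_zero_mem h0 ((mem_smul_iff ht).1 hz) (t := t / r)
      ⟨by positivity, (div_le_one hr0).2 htr.le⟩
    rwa [smul_smul, div_mul_eq_mul_div, mul_inv_cancel₀ ht.ne', one_div] at this
  · exact fun h => iInf_le_of_le ⟨s, hs, (mem_smul_iff hs).2 h⟩ le_rfl

theorem isLinear_absorbed (hA : Convex ℝ A) (h0 : 0 ∈ A) (hneg : ∀ z ∈ A, -z ∈ A) :
    IsLinear {z : Z X | ∃ s : ℝ, 0 < s ∧ s⁻¹ • z ∈ A} := by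
  refine ⟨⟨⟨⟨{z | ∃ s : ℝ, 0 < s ∧ s⁻¹ • z ∈ A}, ?_⟩, ⟨1, one_pos, by simpa using h0⟩⟩, ?_⟩, rfl⟩
  · rintro z w ⟨s, hs, hz⟩ ⟨t, ht, hw⟩
    refine ⟨s + t, by positivity, ?_⟩
    have := hA hz hw (a := s / (s + t)) (b := t / (s + t)) (by positivity) (by positivity)
      (by field_simp)
    convert this using 1
    rw [smul_smul, smul_smul, smul_add]
    congr 2 <;> field_simp
  · rintro t z ⟨s, hs, hz⟩
    refine ⟨s * (|t| + 1), by positivity, ?_⟩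
    have := smul_mem_of_abs_le_one hA h0 hneg (abs_div_abs_add_one_le t) hz
    convert this using 1
    rw [smul_smul, smul_smul]
    congr 1
    field_simp

theorem exists_pos_inv_smul_mem_iff (hA : Convex ℝ A) (h0 : 0 ∈ A) (hneg : ∀ z ∈ A, -z ∈ A)
    {z : Z X} : (∃ s : ℝ, 0 < s ∧ s⁻¹ • z ∈ A) ↔ ∃ t : ℝ, ∃ u ∈ A, z = t • u := by
  constructor
  · rintro ⟨s, hs, hz⟩
    exact ⟨s, _, hz, by rw [smul_smul, mul_inv_cancel₀ hs.ne', one_smul]⟩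
  · rintro ⟨t, u, hu, rfl⟩
    refine ⟨|t| + 1, by positivity, ?_⟩
    rw [smul_smul, inv_mul_eq_div]
    exact smul_mem_of_abs_le_one hA h0 hneg (abs_div_abs_add_one_le t) hu

theorem support_le_coe_iff {z : Z X} {r : ℝ} :
    support A z ≤ r ↔ ∀ u ∈ A, coupling z u ≤ r := by
  simp [support, iSup_le_iff]

theorem support_nonneg (h0 : 0 ∈ A) (z : Z X) : 0 ≤ support A z := by
  refine le_iSup_of_le ⟨0, h0⟩ ?_
  have := coupling_smul_right 0 z 0
  simp only [zero_smul, zero_mul] at this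
  simp [this]

theorem support_closure_convexHull (z : Z X) :
    support (closure (convexHull ℝ A)) z = support A z := by
  refine le_antisymm (EReal.le_of_forall_lt_iff_le.1 fun r hr => ?_) ?_
  · have h : A ⊆ {u | coupling z u ≤ r} := support_le_coe_iff.1 hr.le
    exact support_le_coe_iff.2 fun u hu => closure_minimal
      (convexHull_min h (convex_coupling_le z r))
      (isClosed_le (continuous_coupling z) continuous_const) hu
  · exact iSup_le fun u => le_iSup_of_le
      ⟨u.1, subset_closure (subset_convexHull ℝ A u.2)⟩ le_rfl

theorem mem_bar_iff {z : Z X} : z ∈ bar A ↔ ∃ r : ℝ, 0 < r ∧ ∀ u ∈ A, coupling z u ≤ r :=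
  ereal_lt_top_iff_exists_pos.trans (by simp only [support_le_coe_iff])

theorem isLinear_bar (hA : Convex ℝ A) (h0 : 0 ∈ A) (hneg : ∀ z ∈ A, -z ∈ A) :
    IsLinear (bar A) := by
  refine ⟨⟨⟨⟨bar A, ?_⟩, ?_⟩, ?_⟩, rfl⟩
  · intro z w hz hw
    obtain ⟨r, hr, hz⟩ := mem_bar_iff.1 hz
    obtain ⟨s, hs, hw⟩ := mem_bar_iff.1 hw
    refine mem_bar_iff.2 ⟨r + s, by positivity, fun u hu => ?_⟩
    rw [coupling_add_left]
    exact add_le_add (hz u hu) (hw u hu)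
  · refine mem_bar_iff.2 ⟨1, one_pos, fun u hu => ?_⟩
    rw [← zero_smul ℝ (0 : Z X), coupling_smul_left]
    simp
  · intro t z hz
    obtain ⟨r, hr, hz⟩ := mem_bar_iff.1 hz
    refine mem_bar_iff.2 ⟨(|t| + 1) * r, by positivity, fun u hu => ?_⟩
    have h := hz _ (smul_mem_of_abs_le_one hA h0 hneg (abs_div_abs_add_one_le t) hu)
    rw [coupling_smul_right] at h
    rw [coupling_smul_left]
    calc t * coupling z u = (|t| + 1) * (t / (|t| + 1) * coupling z u) := by field_simp
      _ ≤ _ := by gcongr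

end ConvexSets
-- Sublevel sets of the Fitzpatrick function.
section Fitzpatrick

variable {X : Type*} [AddCommGroup X] [Module ℝ X] [TopologicalSpace X]
  [IsTopologicalAddGroup X] [ContinuousSMul ℝ X] {L : Submodule ℝ (Z X)}

theorem fitzpatrick_le_coe_iff {z : Z X} {r : ℝ} :
    fitzpatrick (L : Set (Z X)) z ≤ r ↔ ∀ l ∈ L, coupling z l - c l ≤ r := by
  simp only [fitzpatrick, conj, iSup_le_iff]
  refine forall_congr' fun l => ?_
  by_cases hl : l ∈ L
  · simp only [cOn, indicator, SetLike.mem_coe, hl, if_true, add_zero, forall_const]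
    exact_mod_cast Iff.rfl
  · simp [cOn, indicator, hl]

theorem fitzpatrick_nonneg (z : Z X) : 0 ≤ fitzpatrick (L : Set (Z X)) z := by
  refine EReal.le_of_forall_lt_iff_le.1 fun r hr => ?_
  have := fitzpatrick_le_coe_iff.1 hr.le 0 L.zero_mem
  have h0 := coupling_smul_right 0 z 0
  simp only [zero_smul, zero_mul] at h0
  rw [h0, c_zero, sub_zero] at this
  exact_mod_cast this

theorem fitzpatrick_smul (hL : IsMonotone (L : Set (Z X))) (z : Z X) (t : ℝ) :
    fitzpatrick (L : Set (Z X)) (t • z) =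
      ((t ^ 2 : ℝ) : EReal) * fitzpatrick (L : Set (Z X)) z := by
  rcases eq_or_ne t 0 with rfl | ht
  · simp only [ne_eq, OfNat.ofNat_ne_zero, not_false_eq_true, zero_pow, EReal.coe_zero, zero_mul]
    refine le_antisymm (fitzpatrick_le_coe_iff.2 fun l hl => ?_) (fitzpatrick_nonneg _)
    rw [coupling_smul_left]
    linarith [hL.c_nonneg hl]
  have ht2 : 0 < t ^ 2 := by positivity
  refine ereal_eq_of_forall_pos (fitzpatrick_nonneg _)
    (ereal_nonneg_mul ht2.le (fitzpatrick_nonneg _)) fun r _ => ?_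
  rw [ereal_pos_mul_le_iff ht2 (fitzpatrick_nonneg _), fitzpatrick_le_coe_iff,
    fitzpatrick_le_coe_iff]
  constructor
  · intro h l hl
    have := h _ (L.smul_mem t hl)
    rw [coupling_smul_left, coupling_smul_right, c_smul] at this
    rw [le_div_iff₀ ht2]
    linarith
  · intro h l hl
    have := h _ (L.smul_mem t⁻¹ hl)
    rw [coupling_smul_right, c_smul, le_div_iff₀ ht2] at this
    rw [coupling_smul_left]
    have e : (t⁻¹ * coupling z l - t⁻¹ ^ 2 * c l) * t ^ 2 = t * coupling z l - c l := by
      field_simp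
    rwa [e] at this

/-- Homogeneity reduces the bound to vectors with `c l ≤ 1`; the constant `2√r` comes from `2√K√r ≤
K + r`. -/
theorem fitzpatrick_le_iff_coupling_le (hL : IsMonotone (L : Set (Z X))) {z : Z X} {r : ℝ}
    (hr : 0 < r) : fitzpatrick (L : Set (Z X)) z ≤ r ↔
      ∀ l ∈ L, c l ≤ 1 → coupling z l ≤ 2 * Real.sqrt r := by
  have hs : 0 < Real.sqrt r := Real.sqrt_pos.2 hr
  have hsq : Real.sqrt r ^ 2 = r := Real.sq_sqrt hr.le
  rw [fitzpatrick_le_coe_iff]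
  constructor
  · intro h l hl hc
    have := h _ (L.smul_mem (Real.sqrt r) hl)
    rw [coupling_smul_right, c_smul, hsq] at this
    refine le_of_mul_le_mul_left ?_ hs
    calc _ ≤ r + r * c l := by linarith
      _ ≤ r + r * 1 := by gcongr
      _ = 2 * Real.sqrt r ^ 2 := by rw [hsq]; ring
      _ = _ := by ring
  · intro h l hl
    have hle : coupling z l - r ≤ c l := by
      -- Normalising by `√K` with `K > c l` avoids dividing by `√(c l)`, which may be zero.
      refine le_of_forall_gt_imp_ge_of_dense fun K hK => ?_
      have hK0 : 0 < K := (hL.c_nonneg hl).trans_lt hK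
      have hk : 0 < Real.sqrt K := Real.sqrt_pos.2 hK0
      have hksq : Real.sqrt K ^ 2 = K := Real.sq_sqrt hK0.le
      have := h _ (L.smul_mem (Real.sqrt K)⁻¹ hl) (by
        rw [c_smul, inv_pow, hksq, inv_mul_le_iff₀ hK0]; linarith)
      rw [coupling_smul_right, inv_mul_le_iff₀ hk] at this
      have := two_mul_le_add_sq (Real.sqrt K) (Real.sqrt r)
      linarith
    linarith

end Fitzpatrick

/-! ### The closed epigraph of `c_L` and the Penot function. -/

section Penot

variable {X : Type*} [AddCommGroup X] [Module ℝ X] [TopologicalSpace X]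
  [IsTopologicalAddGroup X] [ContinuousSMul ℝ X] {L : Submodule ℝ (Z X)}

theorem mem_closure_epi_of_le {z : Z X} {r s : ℝ} (hrs : r ≤ s)
    (h : (z, r) ∈ closure (epi (cOn (L : Set (Z X))))) :
    (z, s) ∈ closure (epi (cOn (L : Set (Z X)))) := by
  have hcont : Continuous fun p : Z X × ℝ => (p.1, p.2 + (s - r)) := by fun_prop
  have := map_mem_closure hcont h (t := epi (cOn (L : Set (Z X)))) fun p hp => by
    obtain ⟨h1, h2⟩ := cOn_le_coe_iff.1 hp
    exact cOn_le_coe_iff.2 ⟨h1, by simp only; linarith⟩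
  simpa using this

/-- The epigraph of `c_L`, hence its closure, lies above `c`. -/
theorem IsMonotone.c_le_of_mem_closure_epi (hL : IsMonotone (L : Set (Z X))) {z : Z X} {r : ℝ}
    (h : (z, r) ∈ closure (epi (cOn (L : Set (Z X))))) : c z ≤ r := by
  have hclosed (w : Z X) (s : ℝ) :
      IsClosed {p : Z X × ℝ | coupling w p.1 ≤ p.2 + s} :=
    isClosed_le ((continuous_coupling w).comp continuous_fst) (by fun_prop)
  -- The form `c` is not passed to the limit directly. The inequality `w · p ≤ c w + c p` is
  -- continuous in `p` for fixed `w`, so one argument is closed up at a time.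
  have h1 (w : Z X) (hw : w ∈ L) : coupling w z ≤ r + c w := by
    refine closure_minimal ?_ (hclosed w (c w)) h
    intro p hp
    obtain ⟨hp, hpc⟩ := cOn_le_coe_iff.1 hp
    change coupling w p.1 ≤ p.2 + c w
    linarith [hL.coupling_le hw hp]
  -- Second passage to the limit, now in the other argument, using `h1`; on the diagonal the
  -- coupling is `2 * c z`.
  have h2 : coupling z z ≤ r + r := by
    refine closure_minimal ?_ (hclosed z r) h
    intro p hp
    obtain ⟨hp, hpc⟩ := cOn_le_coe_iff.1 hp
    change coupling z p.1 ≤ p.2 + r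
    rw [coupling_comm]
    linarith [h1 p.1 hp]
  rw [coupling_self] at h2
  linarith

theorem IsMonotone.nonneg_of_mem_closure_epi (hL : IsMonotone (L : Set (Z X))) {z : Z X} {r : ℝ}
    (h : (z, r) ∈ closure (epi (cOn (L : Set (Z X))))) : 0 ≤ r := by
  have hclosed : IsClosed {p : Z X × ℝ | 0 ≤ p.2} := isClosed_le continuous_const continuous_snd
  refine closure_minimal ?_ hclosed h
  intro p hp
  obtain ⟨hp, hpc⟩ := cOn_le_coe_iff.1 hp
  exact (hL.c_nonneg hp).trans hpc

theorem IsMonotone.penot_nonneg (hL : IsMonotone (L : Set (Z X))) (z : Z X) :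
    0 ≤ penot (L : Set (Z X)) z := by
  refine le_iInf fun ⟨t, ht⟩ => ?_
  rw [hL.convex_epi_cOn.convexHull_eq] at ht
  exact_mod_cast hL.nonneg_of_mem_closure_epi ht

theorem IsMonotone.c_le_penot (hL : IsMonotone (L : Set (Z X))) (z : Z X) :
    (c z : EReal) ≤ penot (L : Set (Z X)) z := by
  refine le_iInf fun ⟨t, ht⟩ => ?_
  rw [hL.convex_epi_cOn.convexHull_eq] at ht
  exact_mod_cast hL.c_le_of_mem_closure_epi ht

theorem penot_le_c {z : Z X} (hz : z ∈ L) : penot (L : Set (Z X)) z ≤ (c z : EReal) :=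
  iInf_le_of_le ⟨c z, subset_closure (subset_convexHull ℝ _ (cOn_le_coe_iff.2 ⟨hz, le_rfl⟩))⟩ le_rfl

theorem IsMonotone.penot_le_coe_iff (hL : IsMonotone (L : Set (Z X))) {z : Z X} {r : ℝ} :
    penot (L : Set (Z X)) z ≤ r ↔ (z, r) ∈ closure (epi (cOn (L : Set (Z X)))) := by
  constructor
  · intro h
    have hlim : Filter.Tendsto (fun s : ℝ => (z, s)) (𝓝[>] r) (𝓝 (z, r)) :=
      ((continuous_const.prodMk continuous_id).tendsto r).mono_left nhdsWithin_le_nhds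
    refine isClosed_closure.mem_of_tendsto hlim ?_
    filter_upwards [self_mem_nhdsWithin] with s hs
    obtain ⟨⟨t, ht⟩, hts⟩ := iInf_lt_iff.1 (h.trans_lt (EReal.coe_lt_coe_iff.2 hs))
    rw [hL.convex_epi_cOn.convexHull_eq] at ht
    exact mem_closure_epi_of_le (by exact_mod_cast hts.le) ht
  · exact fun h => iInf_le_of_le ⟨r, hL.convex_epi_cOn.convexHull_eq.symm ▸ h⟩ le_rfl

/-- The map `(w, s) ↦ w / √s`, continuous where `s > 0`, carries the epigraph into the unit sublevel
set, and `w ↦ (√r • w, r)` goes back. -/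
theorem mem_closure_epi_iff {z : Z X} {r : ℝ} (hr : 0 < r) :
    (z, r) ∈ closure (epi (cOn (L : Set (Z X)))) ↔
      (Real.sqrt r)⁻¹ • z ∈ closure {w : Z X | w ∈ L ∧ c w ≤ 1} := by
  have hs : 0 < Real.sqrt r := Real.sqrt_pos.2 hr
  have hsq : Real.sqrt r ^ 2 = r := Real.sq_sqrt hr.le
  constructor
  · intro h
    have hcont : ContinuousAt (fun p : Z X × ℝ => (Real.sqrt p.2)⁻¹ • p.1) (z, r) :=
      (ContinuousAt.inv₀ (f := fun p : Z X × ℝ => Real.sqrt p.2)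
        (Real.continuous_sqrt.comp continuous_snd).continuousAt hs.ne').smul
        continuous_fst.continuousAt
    have hopen : {p : Z X × ℝ | 0 < p.2} ∈ 𝓝 (z, r) :=
      (isOpen_lt continuous_const continuous_snd).mem_nhds hr
    rw [mem_closure_iff_frequently] at h ⊢
    refine hcont.tendsto.frequently ((h.and_eventually hopen).mono ?_)
    rintro p ⟨hp, hp0⟩
    obtain ⟨hp, hpc⟩ := cOn_le_coe_iff.1 hp
    have hp0 : 0 < p.2 := hp0
    refine ⟨L.smul_mem _ hp, ?_⟩
    rwa [c_smul, inv_pow, Real.sq_sqrt hp0.le, inv_mul_le_iff₀ hp0, mul_one]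
  · intro h
    have hcont : Continuous fun w : Z X => (Real.sqrt r • w, r) := by fun_prop
    have := map_mem_closure hcont h (t := epi (cOn (L : Set (Z X)))) fun w hw => by
      refine cOn_le_coe_iff.2 ⟨L.smul_mem _ hw.1, ?_⟩
      rw [c_smul, hsq]
      exact mul_le_of_le_one_right hr.le hw.2
    rwa [smul_smul, mul_inv_cancel₀ hs.ne', one_smul] at this

end Penot

/-! ### The crown and its relation to both functions. -/

section Crown

variable {X : Type*} [AddCommGroup X] [Module ℝ X] [TopologicalSpace X]
  [IsTopologicalAddGroup X] [ContinuousSMul ℝ X] [LocallyConvexSpace ℝ X] {L : Submodule ℝ (Z X)}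

theorem crown_eq_closure (A : Set (Z X)) : crown A = closure (convexHull ℝ (unitaryPart A)) :=
  clWW_eq_closure (convex_convexHull ℝ _)

theorem convex_crown (A : Set (Z X)) : Convex ℝ (crown A) :=
  crown_eq_closure A ▸ (convex_convexHull ℝ _).closure

theorem isClosed_crown (A : Set (Z X)) : IsClosed (crown A) :=
  crown_eq_closure A ▸ isClosed_closure

theorem bar_crown (A : Set (Z X)) : bar (crown A) = bar (unitaryPart A) := by
  rw [crown_eq_closure]
  exact congrArg dom (funext support_closure_convexHull)

theorem neg_mem_crown {z : Z X} (hz : z ∈ crown (L : Set (Z X))) :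
    -z ∈ crown (L : Set (Z X)) := by
  rw [crown_eq_closure] at hz ⊢
  refine map_mem_closure continuous_neg hz fun w hw => ?_
  have h : -convexHull ℝ (unitaryPart (L : Set (Z X))) =
      convexHull ℝ (unitaryPart (L : Set (Z X))) := by
    rw [← convexHull_neg]
    congr 1
    ext u
    exact ⟨fun hu => neg_neg u ▸ neg_mem_unitaryPart hu, neg_mem_unitaryPart⟩
  rw [← h]
  exact Set.neg_mem_neg.2 hw

theorem convexHull_subset_crown (A : Set (Z X)) : convexHull ℝ (unitaryPart A) ⊆ crown A :=
  crown_eq_closure A ▸ subset_closure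

theorem IsMonotone.skewPart_subset_crown (hL : IsMonotone (L : Set (Z X)))
    (hne : (positivePart (L : Set (Z X))).Nonempty) :
    skewPart (L : Set (Z X)) ⊆ crown (L : Set (Z X)) :=
  (hL.skewPart_subset_convexHull hne).trans (convexHull_subset_crown _)

theorem IsMonotone.zero_mem_crown (hL : IsMonotone (L : Set (Z X)))
    (hne : (positivePart (L : Set (Z X))).Nonempty) : (0 : Z X) ∈ crown (L : Set (Z X)) :=
  hL.skewPart_subset_crown hne zero_mem_skewPart

theorem IsMonotone.asympCone_crown (hL : IsMonotone (L : Set (Z X)))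
    (hne : (positivePart (L : Set (Z X))).Nonempty) :
    asympCone (crown (L : Set (Z X))) =
      {z : Z X | ∀ s : ℝ, 0 < s → s • z ∈ crown (L : Set (Z X))} :=
  asympCone_eq (convex_crown _) (isClosed_crown _) (hL.zero_mem_crown hne)

theorem IsMonotone.skewPart_subset_asympCone (hL : IsMonotone (L : Set (Z X)))
    (hne : (positivePart (L : Set (Z X))).Nonempty) :
    skewPart (L : Set (Z X)) ⊆ asympCone (crown (L : Set (Z X))) := by
  rw [hL.asympCone_crown hne]
  intro z hz s _
  exact hL.skewPart_subset_crown hne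
    ⟨L.smul_mem s hz.1, by rw [c_smul, hz.2, mul_zero]⟩

theorem IsMonotone.bar_crown_subset_orth (hL : IsMonotone (L : Set (Z X)))
    (hne : (positivePart (L : Set (Z X))).Nonempty) :
    bar (crown (L : Set (Z X))) ⊆ orth (skewPart (L : Set (Z X))) := by
  intro z hz s hs
  obtain ⟨r, hr, h⟩ := mem_bar_iff.1 hz
  by_contra hne0
  -- The crown contains the whole line through `s`; a linear functional bounded above on a line
  -- vanishes on it.
  have h1 := h (((r + 1) / coupling s z) • s) (hL.skewPart_subset_crown hne
    ⟨L.smul_mem _ hs.1, by rw [c_smul, hs.2, mul_zero]⟩)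
  rw [coupling_smul_right, coupling_comm z s, div_mul_cancel₀ _ hne0] at h1
  linarith

theorem IsMonotone.support_crown_le_iff (hL : IsMonotone (L : Set (Z X)))
    (hne : (positivePart (L : Set (Z X))).Nonempty) {z : Z X} {r : ℝ} :
    support (crown (L : Set (Z X))) z ≤ r ↔ ∀ l ∈ L, c l ≤ 1 → coupling z l ≤ r := by
  -- Doubling the convex hull lets the support function be reduced to `conv U`, the unit sublevel
  -- set, rather than to `U`.
  rw [crown_eq_closure, ← (convex_convexHull ℝ (unitaryPart (L : Set (Z X)))).convexHull_eq, support_closure_convexHull, support_le_coe_iff,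
    hL.convexHull_unitaryPart hne]
  exact ⟨fun h l hl hc => h l ⟨hl, hc⟩, fun h l hl => h l hl.1 hl.2⟩

theorem IsMonotone.fitzpatrick_eq (hL : IsMonotone (L : Set (Z X)))
    (hne : (positivePart (L : Set (Z X))).Nonempty) (z : Z X) :
    fitzpatrick (L : Set (Z X)) z =
      ((1 / 4 : ℝ) : EReal) * support (crown (L : Set (Z X))) z ^ 2 := by
  have h0 := support_nonneg (hL.zero_mem_crown hne) z
  have h4 : (0 : ℝ) < 1 / 4 := by norm_num
  refine ereal_eq_of_forall_pos (fitzpatrick_nonneg _)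
    (ereal_nonneg_mul h4.le (pow_nonneg h0 2)) fun r hr => ?_
  have hsqrt : Real.sqrt (r / (1 / 4)) = 2 * Real.sqrt r := by
    rw [show r / (1 / 4) = 2 ^ 2 * r by ring, Real.sqrt_mul (by norm_num),
      Real.sqrt_sq (by norm_num)]
  rw [fitzpatrick_le_iff_coupling_le hL hr, ereal_pos_mul_le_iff h4 (pow_nonneg h0 2),
    ereal_sq_le_iff h0, and_iff_left (by positivity), hsqrt, hL.support_crown_le_iff hne]

theorem IsMonotone.dom_fitzpatrick (hL : IsMonotone (L : Set (Z X)))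
    (hne : (positivePart (L : Set (Z X))).Nonempty) :
    dom (fitzpatrick (L : Set (Z X))) = bar (crown (L : Set (Z X))) := by
  ext z
  refine ereal_lt_top_iff_exists_pos.trans (Iff.trans ?_ ereal_lt_top_iff_exists_pos.symm)
  constructor
  · rintro ⟨r, hr, h⟩
    exact ⟨2 * Real.sqrt r, by positivity, (hL.support_crown_le_iff hne).2
      ((fitzpatrick_le_iff_coupling_le hL hr).1 h)⟩
  · rintro ⟨r, hr, h⟩
    refine ⟨(r / 2) ^ 2, by positivity,
      (fitzpatrick_le_iff_coupling_le hL (by positivity)).2 ?_⟩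
    rw [Real.sqrt_sq (by positivity), mul_div_cancel₀ r two_ne_zero]
    exact (hL.support_crown_le_iff hne).1 h

theorem IsMonotone.penot_le_iff_mem_crown (hL : IsMonotone (L : Set (Z X)))
    (hne : (positivePart (L : Set (Z X))).Nonempty) {z : Z X} {r : ℝ} (hr : 0 < r) :
    penot (L : Set (Z X)) z ≤ r ↔ (Real.sqrt r)⁻¹ • z ∈ crown (L : Set (Z X)) := by
  rw [hL.penot_le_coe_iff, mem_closure_epi_iff hr, crown_eq_closure, hL.convexHull_unitaryPart hne]

theorem IsMonotone.penot_eq (hL : IsMonotone (L : Set (Z X)))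
    (hne : (positivePart (L : Set (Z X))).Nonempty) (z : Z X) :
    penot (L : Set (Z X)) z = minkowski (crown (L : Set (Z X))) z ^ 2 := by
  refine ereal_eq_of_forall_pos (hL.penot_nonneg z) (pow_nonneg (minkowski_nonneg z) 2)
    fun r hr => ?_
  rw [hL.penot_le_iff_mem_crown hne hr, ereal_sq_le_iff (minkowski_nonneg z),
    and_iff_left hr.le, minkowski_le_coe_iff (convex_crown _) (isClosed_crown _)
      (hL.zero_mem_crown hne) (Real.sqrt_pos.2 hr)]

theorem IsMonotone.crown_eq_penot_le_one (hL : IsMonotone (L : Set (Z X)))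
    (hne : (positivePart (L : Set (Z X))).Nonempty) :
    crown (L : Set (Z X)) = {z | penot (L : Set (Z X)) z ≤ 1} := by
  ext z
  have := hL.penot_le_iff_mem_crown hne (z := z) one_pos
  simpa using this.symm

theorem IsMonotone.asympCone_crown_eq_penot_eq_zero (hL : IsMonotone (L : Set (Z X)))
    (hne : (positivePart (L : Set (Z X))).Nonempty) :
    asympCone (crown (L : Set (Z X))) = {z | penot (L : Set (Z X)) z = 0} := by
  rw [hL.asympCone_crown hne]
  ext z
  have : penot (L : Set (Z X)) z = 0 ↔ penot (L : Set (Z X)) z ≤ 0 :=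
    ⟨fun h => h.le, fun h => h.antisymm (hL.penot_nonneg z)⟩
  refine Iff.trans ?_ (this.trans ereal_le_zero_iff).symm
  constructor
  · exact fun h r hr => (hL.penot_le_iff_mem_crown hne hr).2 (h _ (by positivity))
  · intro h s hs
    -- The threshold `s⁻¹ ^ 2` turns the factor `(√r)⁻¹` into `s`.
    have := (hL.penot_le_iff_mem_crown hne (by positivity)).1 (h (s⁻¹ ^ 2) (by positivity))
    rwa [Real.sqrt_sq (by positivity), inv_inv] at this

theorem IsMonotone.penot_smul (hL : IsMonotone (L : Set (Z X)))
    (hne : (positivePart (L : Set (Z X))).Nonempty) (z : Z X) (t : ℝ) :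
    penot (L : Set (Z X)) (t • z) = ((t ^ 2 : ℝ) : EReal) * penot (L : Set (Z X)) z := by
  rcases eq_or_ne t 0 with rfl | ht
  · have h := penot_le_c L.zero_mem
    rw [c_zero] at h
    simpa using h.antisymm (hL.penot_nonneg 0)
  have ht2 : 0 < t ^ 2 := by positivity
  refine ereal_eq_of_forall_pos (hL.penot_nonneg _)
    (ereal_nonneg_mul ht2.le (hL.penot_nonneg _)) fun r hr => ?_
  rw [ereal_pos_mul_le_iff ht2 (hL.penot_nonneg _), hL.penot_le_iff_mem_crown hne hr,
    hL.penot_le_iff_mem_crown hne (by positivity), Real.sqrt_div hr.le, Real.sqrt_sq_eq_abs,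
    inv_div, smul_smul]
  -- The square root of `t ^ 2` is `|t|`; the lost sign is absorbed by the symmetry of the crown.
  rcases abs_choice t with h | h <;> rw [h]
  · rw [div_eq_inv_mul]
  · rw [neg_div, neg_smul, div_eq_inv_mul]
    exact ⟨neg_mem_crown, fun h => neg_neg (((Real.sqrt r)⁻¹ * t) • z) ▸ neg_mem_crown h⟩

theorem IsMonotone.dom_penot (hL : IsMonotone (L : Set (Z X)))
    (hne : (positivePart (L : Set (Z X))).Nonempty) :
    dom (penot (L : Set (Z X))) =
      {z : Z X | ∃ s : ℝ, 0 < s ∧ s⁻¹ • z ∈ crown (L : Set (Z X))} := by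
  ext z
  refine ereal_lt_top_iff_exists_pos.trans ?_
  constructor
  · rintro ⟨r, hr, h⟩
    exact ⟨_, Real.sqrt_pos.2 hr, (hL.penot_le_iff_mem_crown hne hr).1 h⟩
  · rintro ⟨s, hs, h⟩
    refine ⟨s ^ 2, by positivity, (hL.penot_le_iff_mem_crown hne (by positivity)).2 ?_⟩
    rwa [Real.sqrt_sq hs.le]

theorem crown_subset_clWW : crown (L : Set (Z X)) ⊆ clWW (L : Set (Z X)) := by
  rw [crown_eq_closure, clWW_eq_closure L.convex]
  exact closure_mono (convexHull_min (fun u hu => hu.1) L.convex)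

theorem IsMonotone.dom_penot_subset (hL : IsMonotone (L : Set (Z X)))
    (hne : (positivePart (L : Set (Z X))).Nonempty) :
    dom (penot (L : Set (Z X))) ⊆ clWW (L : Set (Z X)) := by
  rw [hL.dom_penot hne, clWW_eq_closure L.convex, ← Submodule.topologicalClosure_coe]
  rintro z ⟨s, hs, hz⟩
  have h := crown_subset_clWW hz
  rw [clWW_eq_closure L.convex, ← Submodule.topologicalClosure_coe] at h
  have := L.topologicalClosure.smul_mem s h
  rwa [smul_smul, mul_inv_cancel₀ hs.ne', one_smul] at this

theorem IsMonotone.c_nonpos_of_mem_asympCone (hL : IsMonotone (L : Set (Z X)))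
    (hne : (positivePart (L : Set (Z X))).Nonempty) {z : Z X}
    (hz : z ∈ asympCone (crown (L : Set (Z X)))) : c z ≤ 0 := by
  rw [hL.asympCone_crown_eq_penot_eq_zero hne] at hz
  have := hL.c_le_penot z
  rw [show penot (L : Set (Z X)) z = 0 from hz] at this
  exact_mod_cast this

end Crown

/-! ### Flipping the sign of the second component. -/

section OpNeg

variable {X : Type*} [AddCommGroup X] [Module ℝ X] [TopologicalSpace X]
  [IsTopologicalAddGroup X] [ContinuousSMul ℝ X] {A : Set (Z X)}

theorem isLinear_opNeg (hA : IsLinear A) : IsLinear (opNeg A) := by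
  obtain ⟨M, rfl⟩ := hA
  exact ⟨M.comap (LinearMap.prodMap LinearMap.id (-LinearMap.id)), rfl⟩

theorem isClosed_opNeg (hA : IsClosed A) : IsClosed (opNeg A) :=
  hA.preimage (continuous_fst.prodMk continuous_snd.neg)

/-- The flip changes the sign of `c`, and linearity puts differences back in the set. -/
theorem isMonotone_opNeg (hA : IsLinear A) (hc : ∀ z ∈ A, c z ≤ 0) : IsMonotone (opNeg A) := by
  obtain ⟨M, hM⟩ := isLinear_opNeg hA
  intro z hz w hw
  rw [← hM] at hz hw
  have h : z - w ∈ opNeg A := hM ▸ M.sub_mem hz hw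
  have h1 : (-(z - w).2) (z - w).1 ≤ 0 := hc _ h
  have h2 : (-(z - w).2) (z - w).1 = -c (z - w) := rfl
  linarith

end OpNeg
end MonotoneSubspace

/-- `L` is a monotone linear subspace of `X × X*` with nonempty positive part. -/
theorem theorem5p8 {X : Type*} [AddCommGroup X] [Module ℝ X] [TopologicalSpace X]
    [IsTopologicalAddGroup X] [ContinuousSMul ℝ X] [LocallyConvexSpace ℝ X] [T2Space X]
    (L : Submodule ℝ (Z X)) (hL : IsMonotone (L : Set (Z X)))
    (S P U C : Set (Z X))
    (hS : S = skewPart (L : Set (Z X))) (hP : P = positivePart (L : Set (Z X)))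
    (hU : U = unitaryPart (L : Set (Z X))) (hC : C = crown (L : Set (Z X)))
    (hne : P.Nonempty) :
    -- the skew part is a skew linear subspace
    (IsLinear S ∧ IsSkew S) ∧
    -- the skew part against the unitary and positive parts, the crown and its barrier cone
    (S + U = U ∧ S + P = P ∧ S ⊆ convexHull ℝ U ∧ convexHull ℝ U ⊆ C ∧
      S ⊆ asympCone C ∧ bar U = bar C ∧ bar C ⊆ orth S) ∧
    -- the convex hull of the unitary part is the sublevel set of c_L at 1
    (convexHull ℝ U = {z : Z X | z ∈ L ∧ c z ≤ 1} ∧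
      convexHull ℝ U = {z : Z X | cOn (L : Set (Z X)) z ≤ 1}) ∧
    -- the Fitzpatrick function
    ((∀ z, fitzpatrick (L : Set (Z X)) z = ((1 / 4 : ℝ) : EReal) * support C z ^ 2) ∧
      dom (fitzpatrick (L : Set (Z X))) = bar C ∧ bar C ⊆ orth S ∧
      IsLinear (dom (fitzpatrick (L : Set (Z X)))) ∧
      ∀ (z : Z X) (t : ℝ), fitzpatrick (L : Set (Z X)) (t • z) =
        ((t ^ 2 : ℝ) : EReal) * fitzpatrick (L : Set (Z X)) z) ∧
    -- the Penot function
    ((∀ z, penot (L : Set (Z X)) z = minkowski C z ^ 2) ∧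
      C = {z | penot (L : Set (Z X)) z ≤ 1} ∧
      asympCone C = {z | penot (L : Set (Z X)) z = 0} ∧
      (∀ (z : Z X) (t : ℝ), penot (L : Set (Z X)) (t • z) =
        ((t ^ 2 : ℝ) : EReal) * penot (L : Set (Z X)) z) ∧
      dom (penot (L : Set (Z X))) = {z | ∃ t : ℝ, ∃ u ∈ C, z = t • u} ∧
      IsLinear (dom (penot (L : Set (Z X)))) ∧
      (L : Set (Z X)) ⊆ dom (penot (L : Set (Z X))) ∧
      dom (penot (L : Set (Z X))) ⊆ clWW (L : Set (Z X))) ∧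
    -- the operator -C_∞
    (IsClosedWW (opNeg (asympCone C)) ∧ IsMonotone (opNeg (asympCone C)) ∧
      IsLinear (opNeg (asympCone C))) ∧
    -- the closed case
    (IsClosedWW (L : Set (Z X)) →
      asympCone C = S ∧ IsSkew (asympCone C) ∧ IsClosedWW S) := by
  subst hS hP hU hC
  have hconv := convex_crown (L : Set (Z X))
  have hcl := isClosed_crown (L : Set (Z X))
  have h0 := hL.zero_mem_crown hne
  have hneg : ∀ z ∈ crown (L : Set (Z X)), -z ∈ crown (L : Set (Z X)) := fun _ => neg_mem_crown
  have hlin := isLinear_asympCone hconv hcl h0 hneg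
  have hclosed : IsClosed (asympCone (crown (L : Set (Z X)))) := isClosed_asympCone hconv hcl h0
  have hclWW : IsClosedWW (asympCone (crown (L : Set (Z X)))) :=
    isClosedWW_of_convex (by obtain ⟨M, hM⟩ := hlin; exact hM ▸ M.convex) hclosed
  refine ⟨⟨hL.isLinear_skewPart, fun z hz => hz.2⟩,
    ⟨hL.skewPart_add_unitaryPart, hL.skewPart_add_positivePart,
      hL.skewPart_subset_convexHull hne, convexHull_subset_crown _,
      hL.skewPart_subset_asympCone hne, (bar_crown _).symm, hL.bar_crown_subset_orth hne⟩,
    ⟨hL.convexHull_unitaryPart hne, ?_⟩,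
    ⟨hL.fitzpatrick_eq hne, hL.dom_fitzpatrick hne, hL.bar_crown_subset_orth hne,
      hL.dom_fitzpatrick hne ▸ isLinear_bar hconv h0 hneg, fitzpatrick_smul hL⟩,
    ⟨hL.penot_eq hne, hL.crown_eq_penot_le_one hne, hL.asympCone_crown_eq_penot_eq_zero hne,
      hL.penot_smul hne, ?_, hL.dom_penot hne ▸ isLinear_absorbed hconv h0 hneg,
      fun z hz => (penot_le_c hz).trans_lt (EReal.coe_lt_top _), hL.dom_penot_subset hne⟩,
    ⟨?_, isMonotone_opNeg hlin fun z hz => hL.c_nonpos_of_mem_asympCone hne hz,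
      isLinear_opNeg hlin⟩, fun hLcl => ?_⟩
  · rw [hL.convexHull_unitaryPart hne]
    ext z
    exact (cOn_le_coe_iff (t := 1)).symm
  · rw [hL.dom_penot hne]
    ext z
    exact exists_pos_inv_smul_mem_iff hconv h0 hneg
  · exact isClosedWW_of_convex (by obtain ⟨M, hM⟩ := isLinear_opNeg hlin; exact hM ▸ M.convex)
      (isClosed_opNeg hclosed)
  -- Closedness of `L` keeps the crown, hence `C_∞`, inside `L`, where the bound `c ≤ 0` meets `c ≥
  -- 0`.
  · have hsub : crown (L : Set (Z X)) ⊆ L := by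
      have h := crown_subset_clWW (L := L)
      rwa [clWW_eq_closure L.convex, (isClosed_of_isClosedWW hLcl).closure_eq] at h
    have heq : asympCone (crown (L : Set (Z X))) = skewPart (L : Set (Z X)) := by
      refine Set.Subset.antisymm (fun z hz => ?_) (hL.skewPart_subset_asympCone hne)
      have hzL : z ∈ L := by
        rw [hL.asympCone_crown hne] at hz
        simpa using hsub (hz 1 one_pos)
      exact ⟨hzL, le_antisymm (hL.c_nonpos_of_mem_asympCone hne hz) (hL.c_nonneg hzL)⟩
    exact ⟨heq, heq ▸ fun z hz => hz.2, heq ▸ hclWW⟩
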